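/- Consider an $M/G/1$ queue: customers $1,2,3,\dots$ (numbered in order of arrival) arrive at the points of a Poisson process with intensity $\lambda>0$ on $[0,\infty)$, the system being empty at time $0$. Their service times are nonnegative, independent, identically distributed with distribution $G$, and independent of the arrivals. There is a single server of unit speed, which follows an arbitrary work-conserving service discipline: at each time the server's capacity may be shared in any way among the customers present, is used in full whenever some customer is present, and each customer leaves as soon as the required service has been received (a customer who requires no service may have to wait for the server). For $n\in\mathbb N$ let $\Pi_n\in\mathbb S_n$ be the random permutation that connects the arrival and departure orders of the first $n$ customers, i.e. $\Pi_n(i)$ is the rank of the departure time of customer $i$ among the departure times of customers $1,\dots,n$ (ties, if any, being broken arbitrarily). For $\sigma\in\mathbb S_k$ and $\pi\in\mathbb S_n$ let $$t(\sigma,\pi)=\binom nk^{-1}\#\bigl\{f:[k]\to[n]\text{ strictly increasing}:\ \sigma(i)<\sigma(j)\Leftrightarrow \pi(f(i))<\pi(f(j))\text{ for all }i,j\in[k]\bigr\}$$ if $k\le n$, and $t(\sigma,\pi)=0$ if $k>n$. A permuton is a probability measure on $[0,1]^2$ with uniform marginals, identified with its distribution function $C$ (a copula); $t(\sigma,C)$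 is the probability that $k$ independent points $(X_1,Y_1),\dots,(X_k,Y_k)$ with distribution function $C$ generate $\sigma$, that is, that for each $i\in[k]$ the point with the $i$-th smallest first coordinate has the $\sigma(i)$-th smallest second coordinate. A sequence $\pi_n\in\mathbb S_n$ converges to $C$ in the pattern frequency topology if $t(\sigma,\pi_n)\to t(\sigma,C)$ for every finite permutation $\sigma$. Suppose that the traffic intensity $\rho=\lambda\int x\,G(dx)$ satisfies $\rho<1$ and that the service time distribution has finite third moment, $\int x^3\,G(dx)<\infty$. Then, almost surely, $\Pi_n$ converges in the pattern frequency topology to the permuton $C_\infty$ given by $C_\infty(u,v)=\min\{u,v\}$ for all $u,v\in[0,1]$. -/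

import Mathlib

open MeasureTheory ProbabilityTheory Filter Topology

noncomputable section

namespace PermQueue

/-! ### Patterns in permutations and permutons -/

/-- Relative frequency of the pattern `σ` in the permutation `π`: the proportion of strictly
increasing maps `f : [k] → [n]` such that `π ∘ f` is ordered like `σ`. It is `0` if `k > n`
(then there is no such `f`, and the binomial coefficient is `0`). -/
def patternFreq {k n : ℕ} (σ : Equiv.Perm (Fin k)) (π : Equiv.Perm (Fin n)) : ℝ :=
  (Nat.card {f : Fin k ↪o Fin n // ∀ i j, σ i < σ j ↔ π (f i) < π (f j)} : ℝ) / (n.choose k : ℝ)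

/-- A permuton: a probability measure on the unit square both of whose marginals are uniform. -/
structure Permuton where
  toMeasure : Measure (unitInterval × unitInterval)
  isProbabilityMeasure : IsProbabilityMeasure toMeasure
  map_fst : toMeasure.map Prod.fst = volume
  map_snd : toMeasure.map Prod.snd = volume

/-- The distribution function (copula) `C(u,v)` of a permuton. -/
def Permuton.cdf (C : Permuton) (u v : unitInterval) : ℝ :=
  C.toMeasure.real (Set.Iic u ×ˢ Set.Iic v)

/-- The points `z 0, …, z (k-1)` of the unit square lead to the permutation `σ`: if `ρ` lists them
by increasing (distinct) first coordinates, then the second coordinates, in this order, are distinct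
and have ranks `σ 0, σ 1, …`. -/
def IsPatternOf {k : ℕ} (z : Fin k → unitInterval × unitInterval) (σ : Equiv.Perm (Fin k)) : Prop :=
  ∃ ρ : Equiv.Perm (Fin k), StrictMono (fun i => (z (ρ i)).1) ∧
    ∀ i j, σ i < σ j ↔ (z (ρ i)).2 < (z (ρ j)).2

/-- Pattern frequency `t(σ, C)`: the probability that `k` independent points with distribution `C`
lead to the permutation `σ`. -/
def Permuton.patternFreq (C : Permuton) {k : ℕ} (σ : Equiv.Perm (Fin k)) : ℝ :=
  (Measure.pi (fun _ : Fin k => C.toMeasure)).real {z | IsPatternOf z σ}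

/-- Convergence of a sequence of permutations `π n` of `[n]` to a permuton in the pattern frequency
topology: permutations and permutons are identified with their functions `σ ↦ t(σ, ·)` on the set of
all finite permutations, and the function space carries the product topology. -/
def PatternFreqTendsto (π : ∀ n : ℕ, Equiv.Perm (Fin n)) (C : Permuton) : Prop :=
  Tendsto (fun (n : ℕ) (σ : Σ k : ℕ, Equiv.Perm (Fin k)) => PermQueue.patternFreq σ.2 (π n)) atTop
    (𝓝 (fun σ : Σ k : ℕ, Equiv.Perm (Fin k) => C.patternFreq σ.2))

/-! ### The single server queue -/

/-- Input of an M/G/1 queue: the interarrival times `T i` are exponential with rate `lam` (so that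
customers arrive according to a Poisson process with intensity `lam`), the service times `S i` are
nonnegative with distribution `G`, and all these random variables are independent. -/
structure IsMG1Input {Ω : Type*} [MeasurableSpace Ω] (P : Measure Ω) (lam : ℝ) (G : Measure ℝ)
    (T S : ℕ → Ω → ℝ) : Prop where
  rate_pos : 0 < lam
  measurable_interarrival : ∀ i, Measurable (T i)
  measurable_service : ∀ i, Measurable (S i)
  interarrival_law : ∀ i, P.map (T i) = expMeasure lam
  service_law : ∀ i, P.map (S i) = G
  service_nonneg : ∀ᵐ x ∂G, 0 ≤ x
  indep : iIndepFun (fun k : ℕ ⊕ ℕ => Sum.elim T S k) P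

/-- Arrival time of customer `i` (customers are numbered `0, 1, 2, …` in the order of arrival). -/
def arrivalTime (T : ℕ → ℝ) (i : ℕ) : ℝ := ∑ j ∈ Finset.range (i + 1), T j

/-- One realization of a queue with a single server that has unit speed, is empty before the first
arrival, and uses an arbitrary work-conserving service discipline. Customer `i` arrives at `A i`,
requires the amount `S i` of service, leaves at `D i`, and is in the system on `[A i, D i)`;
`r i t` is the fraction of the server's capacity that customer `i` gets at time `t`. First come first
served, last come first served with or without preemption, service in random order, priority rules
and processor sharing are all of this form. -/
structure IsSingleServerQueue (A S D : ℕ → ℝ) (r : ℕ → ℝ → ℝ) : Prop where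
  arrival_le_departure : ∀ i, A i ≤ D i
  measurable_rate : ∀ i, Measurable (r i)
  rate_nonneg : ∀ i t, 0 ≤ r i t
  /-- only customers in the system are served -/
  rate_eq_zero : ∀ i t, t ∉ Set.Ico (A i) (D i) → r i t = 0
  /-- the server works at full (unit) capacity whenever some customer is in the system -/
  work_conserving : ∀ t, (∃ i, t ∈ Set.Ico (A i) (D i)) → HasSum (fun i => r i t) 1
  /-- on departure a customer has received exactly the required service -/
  served : ∀ i, ∫ t in (A i)..(D i), r i t = S i
  /-- a customer leaves as soon as the service is completed (a customer who requires no service at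
  all may have to wait for the server) -/
  not_served_before : ∀ i, 0 < S i → ∀ t ∈ Set.Ico (A i) (D i), ∫ s in (A i)..t, r i s < S i

/-- `π` connects the arrival order `0, 1, …, n-1` of the first `n` customers with the order of their
departure times: `π i` is the rank of `D i` among `D 0, …, D (n-1)`. Without ties this determines
`π`; ties between departure times may be broken in any way. -/
def IsDeparturePerm (D : ℕ → ℝ) {n : ℕ} (π : Equiv.Perm (Fin n)) : Prop :=
  ∀ i j : Fin n, D i < D j → π i < π j

end PermQueue

end

namespace PermQueue

/-! Let `W n` be the arrival time of customer `n` minus the total service of customers `0, …, n -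
1`. By the strong law `W n / n` tends to `lam⁻¹` minus the mean service time, which stability makes
positive. If `j` overtakes an earlier `i`, then `i` is still present when `j` arrives, so the server
has been busy since the arrival of some `m ≤ i` and has served only `m, …, j - 1`
(`exists_sub_le_sum_service`). Hence `W j ≤ W m`, and the positive drift forces `j - m = o(n)`,
uniformly over `j < n`. So every inversion of the departure permutation has length `o(n)`, whatever
the discipline. A random `k`-subset of `[n]` has two points within `ε n` of each other with
probability `O(ε)`; otherwise it meets no inversion and shows the identity pattern. The diagonal
permuton also produces only identity patterns. -/

theorem integral_id_expMeasure {r : ℝ} (hr : 0 < r) : ∫ x, x ∂(expMeasure r) = r⁻¹ := by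
  have hmeas : Measurable (gammaPDF 1 r) := (measurable_gammaPDFReal 1 r).ennreal_ofReal
  rw [expMeasure, gammaMeasure, integral_withDensity_eq_integral_toReal_smul hmeas
    (Eventually.of_forall fun x => ENNReal.ofReal_lt_top)]
  -- The power `2 - 1` puts the integrand in the form of the integral for `Γ(2)`; the factor `x`
  -- makes the point `0` harmless.
  have hpt : ∀ x : ℝ, (gammaPDF 1 r x).toReal • x
      = (Set.Ioi (0 : ℝ)).indicator (fun x => r * (x ^ ((2 : ℝ) - 1) * Real.exp (-(r * x)))) x := by
    intro x
    rcases lt_or_ge 0 x with hx | hx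
    · rw [Set.indicator_of_mem (Set.mem_Ioi.2 hx), gammaPDF_of_nonneg hx.le,
        ENNReal.toReal_ofReal (by simp; positivity)]
      norm_num
      ring
    · rw [Set.indicator_of_notMem (by simpa using hx)]
      rcases hx.lt_or_eq with hx | rfl
      · simp [gammaPDF_of_neg hx]
      · simp
  simp_rw [hpt]
  rw [integral_indicator measurableSet_Ioi, integral_const_mul,
    Real.integral_rpow_mul_exp_neg_mul_Ioi two_pos hr, Real.Gamma_two]
  norm_num
  field_simp

theorem ae_nonneg_expMeasure (r : ℝ) : ∀ᵐ x ∂(expMeasure r), 0 ≤ x := by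
  have : {x : ℝ | ¬ 0 ≤ x} = Set.Iio 0 := by ext; simp
  rw [ae_iff, this, expMeasure, gammaMeasure, withDensity_apply _ measurableSet_Iio]
  exact lintegral_gammaPDF_of_nonpos le_rfl

/-! ### Work conservation -/

namespace IsSingleServerQueue

variable {A S D : ℕ → ℝ} {r : ℕ → ℝ → ℝ}

theorem rate_le_one (h : IsSingleServerQueue A S D r) (i : ℕ) (t : ℝ) : r i t ≤ 1 := by
  by_cases ht : t ∈ Set.Ico (A i) (D i)
  · exact le_hasSum (h.work_conserving t ⟨i, ht⟩) i fun j _ => h.rate_nonneg j t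
  · rw [h.rate_eq_zero i t ht]
    exact zero_le_one

theorem integrable_rate (h : IsSingleServerQueue A S D r) (i : ℕ) : Integrable (r i) := by
  have hon : IntegrableOn (r i) (Set.Ico (A i) (D i)) := by
    refine Measure.integrableOn_of_bounded (M := 1) (by simp)
      (h.measurable_rate i).aestronglyMeasurable (Eventually.of_forall fun t => ?_)
    rw [Real.norm_of_nonneg (h.rate_nonneg i t)]
    exact h.rate_le_one i t
  exact (integrableOn_iff_integrable_of_support_subset fun t ht =>
    by_contra fun hn => ht (h.rate_eq_zero i t hn)).1 hon

theorem integral_rate (h : IsSingleServerQueue A S D r) (i : ℕ) : ∫ t, r i t = S i := by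
  rw [← h.served i, intervalIntegral.integral_of_le (h.arrival_le_departure i),
    ← integral_Ico_eq_integral_Ioc]
  exact (setIntegral_eq_integral_of_forall_compl_eq_zero (h.rate_eq_zero i)).symm

/-- If customer `i` is still present when customer `j` arrives, then the busy period containing
`A j` begins with the arrival of some customer `m ≤ i`, and since then the server has worked
only for the customers `m, …, j - 1`. -/
theorem exists_sub_le_sum_service (h : IsSingleServerQueue A S D r) (hA : Monotone A) {i j : ℕ}
    (hij : i < j) (hD : A j ≤ D i) :
    ∃ m ≤ i, A j - A m ≤ ∑ l ∈ Finset.Ico m j, S l := by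
  classical
  have hi : ∀ t ∈ Set.Ico (A i) (A j), ∃ l, t ∈ Set.Ico (A l) (D l) :=
    fun t ht => ⟨i, ht.1, ht.2.trans_le hD⟩
  have hex : ∃ m, ∀ t ∈ Set.Ico (A m) (A j), ∃ l, t ∈ Set.Ico (A l) (D l) := ⟨i, hi⟩
  -- Take the least `m` for which the server is busy throughout `[A m, A j)`.
  obtain ⟨m, hm, hmin⟩ : ∃ m, (∀ t ∈ Set.Ico (A m) (A j), ∃ l, t ∈ Set.Ico (A l) (D l)) ∧
      ∀ l < m, ¬ ∀ t ∈ Set.Ico (A l) (A j), ∃ l, t ∈ Set.Ico (A l) (D l) :=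
    ⟨Nat.find hex, Nat.find_spec hex, fun l hl => Nat.find_min hex hl⟩
  have hmi : m ≤ i := not_lt.1 fun hlt => hmin i hlt hi
  -- A customer `l < m` still present after `A m` would extend the busy stretch back to `A l`.
  have hbefore : ∀ l < m, D l ≤ A m := by
    intro l hl
    by_contra! hlt
    refine hmin l hl fun t ht => ?_
    rcases lt_or_ge t (D l) with htD | htD
    · exact ⟨l, ht.1, htD⟩
    · exact hm t ⟨hlt.le.trans htD, ht.2⟩
  have hrate : ∀ t ∈ Set.Ico (A m) (A j), ∑ l ∈ Finset.Ico m j, r l t = 1 := by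
    intro t ht
    refine (hasSum_sum_of_ne_finset_zero fun l hl => ?_).unique (h.work_conserving t (hm t ht))
    refine h.rate_eq_zero l t fun htl => hl (Finset.mem_Ico.2 ⟨?_, ?_⟩)
    · exact not_lt.1 fun hlm => ((hbefore l hlm).trans ht.1).not_gt htl.2
    · exact not_le.1 fun hjl => ((hA hjl).trans htl.1).not_gt ht.2
  refine ⟨m, hmi, ?_⟩
  calc A j - A m = ∫ t in Set.Ico (A m) (A j), (1 : ℝ) := by
        simp [hA (hmi.trans hij.le)]
    _ = ∫ t in Set.Ico (A m) (A j), ∑ l ∈ Finset.Ico m j, r l t :=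
        setIntegral_congr_fun measurableSet_Ico fun t ht => (hrate t ht).symm
    _ = ∑ l ∈ Finset.Ico m j, ∫ t in Set.Ico (A m) (A j), r l t :=
        integral_finsetSum _ fun l _ => (h.integrable_rate l).integrableOn
    _ ≤ ∑ l ∈ Finset.Ico m j, S l := Finset.sum_le_sum fun l _ =>
        (setIntegral_le_integral (h.integrable_rate l)
          (Eventually.of_forall (h.rate_nonneg l))).trans_eq (h.integral_rate l)

end IsSingleServerQueue

/-- A sequence with positive drift `c` cannot fail to increase over a stretch of linear length. -/
theorem eventually_sub_le_of_tendsto_div {W : ℕ → ℝ} {c : ℝ} (hc : 0 < c)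
    (hW : Tendsto (fun n : ℕ => W n / n) atTop (𝓝 c)) {ε : ℝ} (hε : 0 < ε) :
    ∀ᶠ n : ℕ in atTop, ∀ m j : ℕ, m ≤ j → j < n → W j ≤ W m → (j : ℝ) - m ≤ ε * n := by
  -- Four errors of size `δ n` will add up to `c ε n`: the deviations at `j` and at `m`, and the
  -- constant `K` twice. `K` absorbs the indices up to `N`.
  set δ := ε * c / 4 with hδ
  have hδ0 : 0 < δ := by positivity
  obtain ⟨N, hN⟩ := eventually_atTop.1 (Metric.tendsto_nhds.1 hW δ hδ0)
  obtain ⟨K, hK0, hK⟩ : ∃ K : ℝ, 0 ≤ K ∧ ∀ k : ℕ, |W k - c * k| ≤ δ * k + K := by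
    refine ⟨∑ k ∈ Finset.range (N + 1), |W k - c * k|, by positivity, fun k => ?_⟩
    rcases lt_or_ge k (N + 1) with hk | hk
    · have := Finset.single_le_sum (f := fun k : ℕ => |W k - c * k|) (fun i _ => abs_nonneg _)
        (Finset.mem_range.2 hk)
      have h2 : 0 ≤ δ * k := by positivity
      linarith
    · have hk0 : (0 : ℝ) < k := by exact_mod_cast (Nat.succ_pos N).trans_le hk
      have h1 := hN k (by omega)
      rw [Real.dist_eq] at h1
      have h2 : W k - c * k = (W k / k - c) * k := by field_simp
      rw [h2, abs_mul, abs_of_pos hk0]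
      have h3 : 0 ≤ ∑ k ∈ Finset.range (N + 1), |W k - c * k| := by positivity
      nlinarith
  obtain ⟨M, hM⟩ := exists_nat_ge (K / δ)
  filter_upwards [eventually_ge_atTop M] with n hn m j hmj hjn hle
  have hKn : K ≤ δ * n := by
    have : K / δ ≤ n := hM.trans (by exact_mod_cast hn)
    rwa [div_le_iff₀' hδ0] at this
  have hj := abs_le.1 (hK j)
  have hm := abs_le.1 (hK m)
  have hjn' : (j : ℝ) ≤ n := by exact_mod_cast hjn.le
  have hmj' : (m : ℝ) ≤ n := (by exact_mod_cast hmj : (m : ℝ) ≤ j).trans hjn'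
  have e1 : δ * j ≤ δ * n := by gcongr
  have e2 : δ * m ≤ δ * n := by gcongr
  have : c * ((j : ℝ) - m) ≤ c * (ε * n) := by
    have : c * (ε * n) = 4 * (δ * n) := by rw [hδ]; ring
    rw [this]
    linarith [hj.1, hm.2]
  exact le_of_mul_le_mul_left this hc

end PermQueue

namespace PermQueue

/-! ### Permutations whose inversions are short -/

/-- Such an `f` is determined by its values off `j` and by the gap `f j - f i`, which takes at most
`d + 1` values. -/
theorem ncard_orderEmbedding_close_pair_le {k : ℕ} (n d : ℕ) {i j : Fin k} (hij : i < j) :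
    {f : Fin k ↪o Fin n | (f j : ℕ) - f i ≤ d}.ncard ≤ n ^ (k - 1) * (d + 1) := by
  let Φ : {f : Fin k ↪o Fin n | (f j : ℕ) - f i ≤ d} →
      ({x : Fin k // x ≠ j} → Fin n) × Fin (d + 1) :=
    fun f => (fun x => f.1 x.1, ⟨(f.1 j : ℕ) - f.1 i, Nat.lt_succ_of_le f.2⟩)
  have hΦ : Function.Injective Φ := by
    intro f g hfg
    obtain ⟨h1, h2⟩ := Prod.ext_iff.1 hfg
    have hne : ∀ x, x ≠ j → f.1 x = g.1 x := fun x hx => congrFun h1 ⟨x, hx⟩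
    have h2' : (f.1 j : ℕ) - f.1 i = g.1 j - g.1 i := congrArg Fin.val h2
    have hf : (f.1 i : ℕ) < f.1 j := f.1.strictMono hij
    have hg : (g.1 i : ℕ) < g.1 j := g.1.strictMono hij
    have hi : (f.1 i : ℕ) = g.1 i := congrArg Fin.val (hne i hij.ne)
    refine Subtype.ext (DFunLike.ext _ _ fun x => ?_)
    by_cases hx : x = j
    · subst hx
      exact Fin.ext (by omega)
    · exact hne x hx
  have := Nat.card_le_card_of_injective Φ hΦ
  rw [Nat.card_coe_set_eq] at this
  refine this.trans (le_of_eq ?_)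
  simp [Nat.card_eq_fintype_card, Fintype.card_subtype_compl]

theorem ncard_orderEmbedding_exists_close_pair_le (k n d : ℕ) :
    {f : Fin k ↪o Fin n | ∃ i j, i < j ∧ (f j : ℕ) - f i ≤ d}.ncard
      ≤ k ^ 2 * (n ^ (k - 1) * (d + 1)) := by
  let s : Finset (Fin k × Fin k) := Finset.univ.filter fun p => p.1 < p.2
  have hset : {f : Fin k ↪o Fin n | ∃ i j, i < j ∧ (f j : ℕ) - f i ≤ d}
      = ⋃ p ∈ s, {f : Fin k ↪o Fin n | (f p.2 : ℕ) - f p.1 ≤ d} := by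
    ext f
    simp [s]
  rw [hset]
  calc _ ≤ ∑ p ∈ s, {f : Fin k ↪o Fin n | (f p.2 : ℕ) - f p.1 ≤ d}.ncard :=
        Finset.set_ncard_biUnion_le _ _
    _ ≤ ∑ _p ∈ s, n ^ (k - 1) * (d + 1) := Finset.sum_le_sum fun p hp =>
        ncard_orderEmbedding_close_pair_le n d (Finset.mem_filter.1 hp).2
    _ ≤ k ^ 2 * (n ^ (k - 1) * (d + 1)) := by
        rw [Finset.sum_const, smul_eq_mul]
        refine Nat.mul_le_mul_right _ ((Finset.card_le_univ s).trans (le_of_eq ?_))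
        simp [sq]

theorem natCard_orderEmbedding_fin (k n : ℕ) : Nat.card (Fin k ↪o Fin n) = n.choose k := by
  rw [Nat.card_congr Set.powersetCard.ofFinEmbEquiv, Set.powersetCard.card, Nat.card_fin]

theorem lt_iff_lt_iff_eq_one {k : ℕ} (σ : Equiv.Perm (Fin k)) :
    (∀ i j, σ i < σ j ↔ i < j) ↔ σ = 1 := by
  refine ⟨fun h => (Equiv.Perm.monotone_iff σ).1 ?_, fun h => by simp [h]⟩
  exact StrictMono.monotone fun i j hij => (h i j).2 hij

/-- An embedding whose image points are pairwise more than `d` apart meets no inversion of `π`, so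
only those with a close pair contribute to the error. -/
theorem abs_patternFreq_sub_le {k n d : ℕ} (hkn : k ≤ n) (σ : Equiv.Perm (Fin k))
    (π : Equiv.Perm (Fin n)) (hπ : ∀ p q : Fin n, p < q → π q < π p → (q : ℕ) - p ≤ d) :
    |patternFreq σ π - if σ = 1 then 1 else 0|
      ≤ ((k ^ 2 * (n ^ (k - 1) * (d + 1)) : ℕ) : ℝ) / n.choose k := by
  set B := {f : Fin k ↪o Fin n | ∃ i j, i < j ∧ (f j : ℕ) - f i ≤ d} with hB
  set F := {f : Fin k ↪o Fin n | ∀ i j, σ i < σ j ↔ π (f i) < π (f j)} with hF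
  have hBle : B.ncard ≤ k ^ 2 * (n ^ (k - 1) * (d + 1)) :=
    ncard_orderEmbedding_exists_close_pair_le k n d
  have hchoose : (0 : ℝ) < n.choose k := by exact_mod_cast Nat.choose_pos hkn
  have hfreq : patternFreq σ π = F.ncard / n.choose k := by
    rw [patternFreq, hF, ← Nat.card_coe_set_eq]
    rfl
  have hgood : ∀ f ∉ B, ∀ i j, π (f i) < π (f j) ↔ i < j := by
    intro f hf
    have hlt : ∀ i j, i < j → π (f i) < π (f j) := by
      intro i j hij
      by_contra hn
      have hne : π (f j) ≠ π (f i) := fun h => hij.ne' (f.injective (π.injective h))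
      exact hf ⟨i, j, hij, hπ _ _ (f.strictMono hij) (lt_of_le_of_ne (not_lt.1 hn) hne)⟩
    exact fun i j => (show StrictMono fun i => π (f i) from hlt).lt_iff_lt
  rw [hfreq]
  by_cases hσ : σ = 1
  · rw [if_pos hσ]
    have hsub : Fᶜ ⊆ B := by
      intro f hf
      by_contra hfB
      exact hf fun i j => by rw [hgood f hfB i j, hσ]; rfl
    have h1 : F.ncard + Fᶜ.ncard = n.choose k := by
      rw [Set.ncard_add_ncard_compl, natCard_orderEmbedding_fin]
    have h2 : Fᶜ.ncard ≤ k ^ 2 * (n ^ (k - 1) * (d + 1)) := (Set.ncard_le_ncard hsub).trans hBle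
    have h1' : (F.ncard : ℝ) + Fᶜ.ncard = n.choose k := by exact_mod_cast h1
    have h3 : (F.ncard : ℝ) / n.choose k - 1 = -(Fᶜ.ncard / n.choose k) := by
      field_simp
      linarith
    rw [h3, abs_neg, abs_of_nonneg (by positivity)]
    gcongr
  · rw [if_neg hσ, sub_zero, abs_of_nonneg (by positivity)]
    have hsub : F ⊆ B := by
      intro f hf
      by_contra hfB
      exact hσ ((lt_iff_lt_iff_eq_one σ).1 fun i j => (hf i j).trans (hgood f hfB i j))
    have h2 : F.ncard ≤ k ^ 2 * (n ^ (k - 1) * (d + 1)) := (Set.ncard_le_ncard hsub).trans hBle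
    gcongr

theorem tendsto_patternFreq_of_short_inversions {π : ∀ n : ℕ, Equiv.Perm (Fin n)}
    (hπ : ∀ ε : ℝ, 0 < ε → ∀ᶠ n : ℕ in atTop, ∀ p q : Fin n, p < q → π n q < π n p →
      ((q : ℕ) : ℝ) - (p : ℕ) ≤ ε * n) {k : ℕ} (σ : Equiv.Perm (Fin k)) :
    Tendsto (fun n => patternFreq σ (π n)) atTop (𝓝 (if σ = 1 then 1 else 0)) := by
  rw [Metric.tendsto_nhds]
  intro η hη
  -- The `+ 1` keeps `c` positive when `k = 0`; with `ε = η / (4 c)` the final bound is `η / 2`.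
  set c : ℝ := k ^ 2 * 2 ^ k * k.factorial + 1 with hc
  have hc0 : 0 < c := by positivity
  set ε := η / (4 * c) with hε
  have hε0 : 0 < ε := by positivity
  obtain ⟨M, hM⟩ := exists_nat_ge (1 / ε)
  filter_upwards [hπ ε hε0, eventually_ge_atTop (2 * k + 1), eventually_ge_atTop M]
    with n hn hkn hMn
  rw [Real.dist_eq]
  have hn0 : (0 : ℝ) < n := by exact_mod_cast (by omega : 0 < n)
  have h1n : 1 ≤ ε * n := by
    have : 1 / ε ≤ n := hM.trans (by exact_mod_cast hMn)
    rwa [div_le_iff₀' hε0] at this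
  have hπ' : ∀ p q : Fin n, p < q → π n q < π n p → (q : ℕ) - p ≤ ⌊ε * n⌋₊ := by
    intro p q hpq hlt
    refine Nat.le_floor ?_
    rw [Nat.cast_sub (le_of_lt hpq)]
    exact hn p q hpq hlt
  refine (abs_patternFreq_sub_le (by omega) σ (π n) hπ').trans_lt ?_
  have hchoose : ((n : ℝ) / 2) ^ k / k.factorial ≤ n.choose k := by
    refine le_trans ?_ (Nat.pow_le_choose k n)
    have : (n : ℝ) / 2 ≤ ((n + 1 - k : ℕ) : ℝ) := by
      rw [div_le_iff₀ two_pos]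
      exact_mod_cast (by omega : n ≤ (n + 1 - k) * 2)
    gcongr
  have hchoose0 : (0 : ℝ) < n.choose k := lt_of_lt_of_le (by positivity) hchoose
  have hfloor : ((⌊ε * n⌋₊ : ℕ) : ℝ) + 1 ≤ 2 * (ε * n) := by
    linarith [Nat.floor_le (show 0 ≤ ε * n by positivity)]
  rw [div_lt_iff₀ hchoose0]
  push_cast
  -- For `k = 0` the exponent `k - 1` truncates, but the factor `k ^ 2` vanishes.
  rcases Nat.eq_zero_or_pos k with hk | hk
  · subst hk
    simpa using hη
  have hpow : (n : ℝ) ^ (k - 1) * n = n ^ k := by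
    rw [← pow_succ, Nat.sub_add_cancel hk]
  calc (k : ℝ) ^ 2 * (n ^ (k - 1) * (⌊ε * n⌋₊ + 1))
      ≤ (k : ℝ) ^ 2 * (n ^ (k - 1) * (2 * (ε * n))) := by gcongr
    _ = 2 * ε * (k ^ 2 * 2 ^ k * k.factorial) * (((n : ℝ) / 2) ^ k / k.factorial) := by
        rw [div_pow, ← hpow]
        field_simp
    _ ≤ 2 * ε * c * n.choose k := by
        gcongr
        linarith
    _ < η * n.choose k := by
        gcongr
        rw [hε]
        field_simp
        norm_num

/-! ### The permuton concentrated on the diagonal -/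

theorem measurable_diag : Measurable fun x : unitInterval => (x, x) := by fun_prop

/-- The distribution of `(U, U)` with `U` uniform on the unit interval. -/
noncomputable def diagonalPermuton : Permuton where
  toMeasure := (volume : Measure unitInterval).map fun x => (x, x)
  isProbabilityMeasure := Measure.isProbabilityMeasure_map measurable_diag.aemeasurable
  map_fst := by
    rw [Measure.map_map measurable_fst measurable_diag]
    exact Measure.map_id
  map_snd := by
    rw [Measure.map_map measurable_snd measurable_diag]
    exact Measure.map_id

theorem cdf_diagonalPermuton (u v : unitInterval) :
    diagonalPermuton.cdf u v = min (u : ℝ) (v : ℝ) := by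
  have hpre : (fun x : unitInterval => (x, x)) ⁻¹' (Set.Iic u ×ˢ Set.Iic v)
      = Set.Iic (min u v) := by
    ext x
    simp
  rw [Permuton.cdf, diagonalPermuton, measureReal_def,
    Measure.map_apply measurable_diag (measurableSet_Iic.prod measurableSet_Iic), hpre,
    unitInterval.volume_Iic, ENNReal.toReal_ofReal (min u v).2.1]
  exact Monotone.map_min (Subtype.mono_coe _)

/-- Two coordinates have joint law `μ.prod μ`, for which the diagonal is null by Fubini since points
are null. -/
theorem ae_injective_pi {k : ℕ} {α : Type*} [MeasurableSpace α] [MeasurableEq α]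
    (μ : Measure α) [IsProbabilityMeasure μ] [NullSingletonClass μ] :
    ∀ᵐ x ∂(Measure.pi fun _ : Fin k => μ), Function.Injective x := by
  have hpair : ∀ i j : Fin k, i ≠ j → ∀ᵐ x ∂(Measure.pi fun _ : Fin k => μ), x i ≠ x j := by
    intro i j hij
    have hind : iIndepFun (fun (i : Fin k) (x : Fin k → α) => x i)
        (Measure.pi fun _ : Fin k => μ) :=
      iIndepFun_pi (X := fun _ => id) fun _ => aemeasurable_id
    have hmap := (indepFun_iff_map_prod_eq_prod_map_map (measurable_pi_apply i).aemeasurable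
      (measurable_pi_apply j).aemeasurable).1 (hind.indepFun hij)
    rw [(measurePreserving_eval (fun _ : Fin k => μ) i).map_eq,
      (measurePreserving_eval (fun _ : Fin k => μ) j).map_eq] at hmap
    have hdiag : ∀ᵐ z ∂(μ.prod μ), z.1 ≠ z.2 := by
      have hms : MeasurableSet {z : α × α | z.1 ≠ z.2} := measurableSet_diagonal.compl
      rw [Measure.ae_prod_iff_ae_ae hms]
      refine Eventually.of_forall fun a => ?_
      rw [ae_iff]
      simp
    rw [← hmap] at hdiag
    exact ae_of_ae_map (f := fun x : Fin k → α => (x i, x j)) (by fun_prop) hdiag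
  have hall : ∀ᵐ x ∂(Measure.pi fun _ : Fin k => μ), ∀ i j : Fin k, i ≠ j → x i ≠ x j := by
    simp only [ae_all_iff]
    exact hpair
  filter_upwards [hall] with x hx i j h
  by_contra hne
  exact hx i j hne h

theorem isPatternOf_diag_iff {k : ℕ} {x : Fin k → unitInterval} (hx : Function.Injective x)
    (σ : Equiv.Perm (Fin k)) : IsPatternOf (fun i => (x i, x i)) σ ↔ σ = 1 := by
  constructor
  · rintro ⟨ρ, hρ, h⟩
    exact (lt_iff_lt_iff_eq_one σ).1 fun i j => (h i j).trans hρ.lt_iff_lt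
  · rintro rfl
    have hmono : StrictMono fun i => x (Tuple.sort x i) :=
      (Tuple.monotone_sort x).strictMono_of_injective (hx.comp (Tuple.sort x).injective)
    exact ⟨Tuple.sort x, hmono, fun i j => hmono.lt_iff_lt.symm⟩

theorem patternFreq_diagonalPermuton {k : ℕ} (σ : Equiv.Perm (Fin k)) :
    diagonalPermuton.patternFreq σ = if σ = 1 then 1 else 0 := by
  have hprob := diagonalPermuton.isProbabilityMeasure
  have hpi : Measure.pi (fun _ : Fin k => diagonalPermuton.toMeasure)
      = (Measure.pi fun _ : Fin k => (volume : Measure unitInterval)).map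
        fun x i => (x i, x i) := by
    have hfin : ∀ _ : Fin k, SigmaFinite
        ((volume : Measure unitInterval).map fun x => (x, x)) := fun _ =>
      haveI := Measure.isProbabilityMeasure_map (μ := (volume : Measure unitInterval))
        measurable_diag.aemeasurable
      inferInstance
    exact (Measure.pi_map_pi (μ := fun _ : Fin k => (volume : Measure unitInterval))
      (f := fun _ x => (x, x)) fun _ => measurable_diag.aemeasurable).symm
  have hmeas : Measurable fun (x : Fin k → unitInterval) (i : Fin k) => (x i, x i) := by fun_prop
  have hae : ∀ᵐ z ∂(Measure.pi fun _ : Fin k => diagonalPermuton.toMeasure),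
      IsPatternOf z σ ↔ σ = 1 := by
    -- Transferring an almost sure statement through the map requires a measurable set; this one has
    -- full measure and on it the pattern is decided.
    have hset : MeasurableSet {z : Fin k → unitInterval × unitInterval |
        (Function.Injective fun i => (z i).1) ∧ ∀ i, (z i).1 = (z i).2} := by
      have h1 : {z : Fin k → unitInterval × unitInterval |
          (Function.Injective fun i => (z i).1) ∧ ∀ i, (z i).1 = (z i).2}
          = (⋂ (i) (j), {z | (z i).1 = (z j).1 → i = j}) ∩ ⋂ i, {z | (z i).1 = (z i).2} := by
        ext z
        simp [Function.Injective]
      rw [h1]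
      refine (MeasurableSet.iInter fun i => MeasurableSet.iInter fun j => ?_).inter
        (MeasurableSet.iInter fun i => measurableSet_eq_fun (by fun_prop) (by fun_prop))
      exact (measurableSet_eq_fun (by fun_prop) (by fun_prop)).imp (MeasurableSet.const _)
    have : ∀ᵐ z ∂(Measure.pi fun _ : Fin k => diagonalPermuton.toMeasure),
        (Function.Injective fun i => (z i).1) ∧ ∀ i, (z i).1 = (z i).2 := by
      rw [hpi, ae_map_iff hmeas.aemeasurable hset]
      filter_upwards [ae_injective_pi (k := k) (volume : Measure unitInterval)] with x hx
      exact ⟨hx, fun _ => rfl⟩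
    filter_upwards [this] with z hz
    have hz' : z = fun i => ((z i).1, (z i).1) := funext fun i => Prod.ext rfl (hz.2 i).symm
    rw [hz']
    exact isPatternOf_diag_iff hz.1 σ
  have hset : {z | IsPatternOf z σ} =ᵐ[Measure.pi fun _ : Fin k => diagonalPermuton.toMeasure]
      {_z | σ = 1} := by
    filter_upwards [hae] with z hz
    exact propext hz
  rw [Permuton.patternFreq, measureReal_congr hset]
  by_cases hσ : σ = 1 <;> simp [hσ]

end PermQueue

namespace PermQueue

/-! ### Laws of large numbers for the input, and the drift of the queue -/

namespace IsMG1Input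

variable {Ω : Type*} [MeasurableSpace Ω] {P : Measure Ω} {lam : ℝ} {G : Measure ℝ}
  {T S : ℕ → Ω → ℝ}

theorem ae_interarrival_nonneg (h : IsMG1Input P lam G T S) : ∀ᵐ ω ∂P, ∀ i, 0 ≤ T i ω := by
  rw [ae_all_iff]
  intro i
  refine ae_of_ae_map (h.measurable_interarrival i).aemeasurable ?_
  rw [h.interarrival_law i]
  exact ae_nonneg_expMeasure lam

theorem ae_tendsto_interarrival (h : IsMG1Input P lam G T S) :
    ∀ᵐ ω ∂P, Tendsto (fun n : ℕ => (∑ i ∈ Finset.range n, T i ω) / n) atTop (𝓝 lam⁻¹) := by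
  have hmean : ∫ ω, T 0 ω ∂P = lam⁻¹ := by
    rw [← integral_id_expMeasure h.rate_pos, ← h.interarrival_law 0]
    exact (integral_map (h.measurable_interarrival 0).aemeasurable
      aestronglyMeasurable_id).symm
  -- A non-integrable function has Bochner integral `0`, so a nonzero mean gives integrability.
  have hint : Integrable (T 0) P :=
    .of_integral_ne_zero (by rw [hmean]; exact inv_ne_zero h.rate_pos.ne')
  rw [← hmean]
  refine strong_law_ae_real T hint (fun i j hij => ?_) fun i =>
    ⟨(h.measurable_interarrival i).aemeasurable, (h.measurable_interarrival 0).aemeasurable, ?_⟩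
  · exact h.indep.indepFun (i := Sum.inl i) (j := Sum.inl j) (by simpa using hij)
  · rw [h.interarrival_law i, h.interarrival_law 0]

theorem ae_tendsto_service (h : IsMG1Input P lam G T S) (hG : Integrable (fun x : ℝ => x) G) :
    ∀ᵐ ω ∂P, Tendsto (fun n : ℕ => (∑ i ∈ Finset.range n, S i ω) / n) atTop
      (𝓝 (∫ x, x ∂G)) := by
  have hmean : ∫ ω, S 0 ω ∂P = ∫ x, x ∂G := by
    rw [← h.service_law 0]
    exact (integral_map (h.measurable_service 0).aemeasurable aestronglyMeasurable_id).symm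
  have hint : Integrable (S 0) P := by
    rw [← h.service_law 0] at hG
    exact hG.comp_measurable (h.measurable_service 0)
  rw [← hmean]
  refine strong_law_ae_real S hint (fun i j hij => ?_) fun i =>
    ⟨(h.measurable_service i).aemeasurable, (h.measurable_service 0).aemeasurable, ?_⟩
  · exact h.indep.indepFun (i := Sum.inr i) (j := Sum.inr j) (by simpa using hij)
  · rw [h.service_law i, h.service_law 0]

end IsMG1Input

/-- In a stable queue, the first `n` customers are overtaken only by customers that arrive
`o(n)` later. -/
theorem short_inversions_of_drift {T S D : ℕ → ℝ} {r : ℕ → ℝ → ℝ} {a b : ℝ} (hab : b < a)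
    (hT : ∀ i, 0 ≤ T i)
    (hTlim : Tendsto (fun n : ℕ => (∑ i ∈ Finset.range n, T i) / n) atTop (𝓝 a))
    (hSlim : Tendsto (fun n : ℕ => (∑ i ∈ Finset.range n, S i) / n) atTop (𝓝 b))
    (hq : IsSingleServerQueue (arrivalTime T) S D r) {π : ∀ n : ℕ, Equiv.Perm (Fin n)}
    (hπ : ∀ n, IsDeparturePerm D (π n)) {ε : ℝ} (hε : 0 < ε) :
    ∀ᶠ n : ℕ in atTop, ∀ p q : Fin n, p < q → π n q < π n p →
      ((q : ℕ) : ℝ) - (p : ℕ) ≤ ε * n := by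
  set W : ℕ → ℝ := fun n => arrivalTime T n - ∑ i ∈ Finset.range n, S i with hW
  have hA : Monotone (arrivalTime T) := monotone_nat_of_le_succ fun n => by
    rw [arrivalTime, arrivalTime, Finset.sum_range_succ _ (n + 1)]
    exact le_add_of_nonneg_right (hT _)
  have hAlim : Tendsto (fun n : ℕ => arrivalTime T n / n) atTop (𝓝 a) := by
    -- `arrivalTime T n` has `n + 1` terms: shift the index and multiply by `(n + 1) / n`.
    have h1 := (tendsto_add_atTop_iff_nat 1).2 hTlim
    have h2 : Tendsto (fun n : ℕ => 1 + 1 / (n : ℝ)) atTop (𝓝 (1 + 0)) :=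
      tendsto_const_nhds.add tendsto_one_div_atTop_nhds_zero_nat
    have h3 := h1.mul h2
    rw [add_zero, mul_one] at h3
    refine h3.congr' ?_
    filter_upwards [eventually_gt_atTop 0] with n hn
    have : (0 : ℝ) < n := by exact_mod_cast hn
    rw [arrivalTime]
    push_cast
    field_simp
  have hWlim : Tendsto (fun n : ℕ => W n / n) atTop (𝓝 (a - b)) := by
    refine (hAlim.sub hSlim).congr fun n => ?_
    rw [hW, sub_div]
  filter_upwards [eventually_sub_le_of_tendsto_div (sub_pos.2 hab) hWlim hε] with n hn p q hpq hlt
  -- Only a weak inequality, since ties may be broken either way; it suffices for `A q ≤ D p`.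
  have hD : D q ≤ D p := not_lt.1 fun h => (hπ n p q h).not_gt hlt
  obtain ⟨m, hmp, hm⟩ := hq.exists_sub_le_sum_service hA (i := p) (j := q) hpq
    ((hq.arrival_le_departure q).trans hD)
  have hmq : m ≤ (q : ℕ) := hmp.trans (le_of_lt hpq)
  have hWle : W q ≤ W m := by
    rw [Finset.sum_Ico_eq_sub _ hmq] at hm
    simp only [hW]
    linarith
  have := hn m q hmq q.2 hWle
  have : (m : ℝ) ≤ (p : ℕ) := by exact_mod_cast hmp
  linarith

theorem integrable_id_of_integrable_pow_three {μ : Measure ℝ} [IsFiniteMeasure μ]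
    (h : Integrable (fun x : ℝ => x ^ 3) μ) : Integrable (fun x : ℝ => x) μ := by
  refine ((integrable_const (1 : ℝ)).add h.norm).mono' aestronglyMeasurable_id
    (Eventually.of_forall fun x => ?_)
  simp only [Pi.add_apply, norm_pow, Real.norm_eq_abs]
  rcases le_or_gt |x| 1 with hx | hx
  · have : 0 ≤ |x| ^ 3 := by positivity
    linarith
  · have : |x| ≤ |x| ^ 3 := le_self_pow₀ hx.le (by norm_num)
    linarith

end PermQueue


theorem mainTheorem3 {Ω : Type*} [MeasurableSpace Ω] (P : Measure Ω) [IsProbabilityMeasure P]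
    (lam : ℝ) (G : Measure ℝ) (T S : ℕ → Ω → ℝ)
    (hinput : PermQueue.IsMG1Input P lam G T S)
    (hthird : Integrable (fun x : ℝ => x ^ 3) G)
    (hstable : lam * (∫ x, x ∂G) < 1)
    (D : ℕ → Ω → ℝ) (r : ℕ → Ω → ℝ → ℝ)
    (hqueue : ∀ᵐ ω ∂P, PermQueue.IsSingleServerQueue
      (PermQueue.arrivalTime (fun i => T i ω)) (fun i => S i ω) (fun i => D i ω) (fun i => r i ω))
    (Perm : ∀ n : ℕ, Ω → Equiv.Perm (Fin n))
    (hPerm : ∀ᵐ ω ∂P, ∀ n : ℕ, PermQueue.IsDeparturePerm (fun i => D i ω) (Perm n ω)) :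
    ∃ C : PermQueue.Permuton, (∀ u v : unitInterval, C.cdf u v = min (u : ℝ) (v : ℝ)) ∧
      ∀ᵐ ω ∂P, PermQueue.PatternFreqTendsto (fun n => Perm n ω) C := by
  have hG : IsProbabilityMeasure G := by
    rw [← hinput.service_law 0]
    exact Measure.isProbabilityMeasure_map (hinput.measurable_service 0).aemeasurable
  have hdrift : ∫ x, x ∂G < lam⁻¹ := by
    rwa [← one_div, lt_div_iff₀' hinput.rate_pos]
  refine ⟨PermQueue.diagonalPermuton, PermQueue.cdf_diagonalPermuton, ?_⟩
  filter_upwards [hqueue, hPerm, hinput.ae_interarrival_nonneg, hinput.ae_tendsto_interarrival,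
    hinput.ae_tendsto_service (PermQueue.integrable_id_of_integrable_pow_three hthird)]
    with ω hq hπ hT hTlim hSlim
  refine tendsto_pi_nhds.2 fun σ => ?_
  rw [PermQueue.patternFreq_diagonalPermuton]
  exact PermQueue.tendsto_patternFreq_of_short_inversions
    (fun ε hε => PermQueue.short_inversions_of_drift hdrift hT hTlim hSlim hq hπ hε) σ.2
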